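/- Let $n\ge 5$ be an integer, $B$ an $n$-element set and $p$ a prime. Let $\mathrm{Perm}(B)$ be the group of permutations of $B$ and $\mathrm{Alt}(B)$ its alternating subgroup. The group $\mathrm{Perm}(B)$ acts on the space $\mathbb F_p^B$ of maps $h:B\to\mathbb F_p$ by $(sh)(b)=h(s^{-1}b)$, preserving the hyperplane $(\mathbb F_p^B)^0=\{h\mid \sum_{b\in B}h(b)=0\}$ and the line $\mathbb F_p\cdot 1_B$ of constant functions. Let $V=(\mathbb F_p^B)^{00}$ be the heart of this representation: $V=(\mathbb F_p^B)^0/(\mathbb F_p\cdot 1_B)$ if $p\mid n$, and $V=(\mathbb F_p^B)^0$ if $p\nmid n$; let $\rho:\mathrm{Perm}(B)\to\mathrm{Aut}_{\mathbb F_p}(V)$ be the induced representation. For a subgroup $G\subset\mathrm{Perm}(B)$, an $\mathbb F_p$-subalgebra $R\subset\mathrm{End}_{\mathbb F_p}(V)$ containing $\mathrm{Id}$ is called $G$-normal if $\rho(\sigma)R\rho(\sigma)^{-1}\subset R$ for all $\sigma\in G$. The $G$-module $V$ is called very simple if every $G$-normal subalgebra equals $\mathbb F_p\cdot\mathrm{Id}$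 or $\mathrm{End}_{\mathbb F_p}(V)$, and central simple if every $G$-normal subalgebra is a central simple $\mathbb F_p$-algebra. Then: (i) The $\mathrm{Perm}(B)$-module $V$ is very simple. (ii) The $\mathrm{Alt}(B)$-module $V$ is very simple if and only if either $n>5$, or $n=5$ and $p\not\equiv\pm1\bmod 5$. (iii) If $n=5$, $p\equiv\pm1\bmod 5$ and $R\subset\mathrm{End}_{\mathbb F_p}(V)$ is an $\mathrm{Alt}(B)$-normal subalgebra, then either $R=\mathbb F_p\cdot\mathrm{Id}$, or $R=\mathrm{End}_{\mathbb F_p}(V)$, or the $\mathbb F_p$-algebra $R$ is isomorphic to the matrix algebra $\mathrm{Mat}_2(\mathbb F_p)$. (iv) The $\mathrm{Alt}(B)$-module $V$ is central simple. -/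

import Mathlib

namespace HeartModule

section NormalSubalgebras

variable {F G V : Type*} [Field F] [Group G] [AddCommGroup V] [Module F V]

/-- A subalgebra `R` of `End_F(V)` is `G`-normal if `ρ(σ) R ρ(σ)⁻¹ ⊆ R` for all `σ ∈ G`. -/
def IsNormalSubalgebra (ρ : Representation F G V) (R : Subalgebra F (Module.End F V)) : Prop :=
  ∀ σ : G, ∀ u ∈ R, ρ σ * u * ρ σ⁻¹ ∈ R

/-- A subalgebra of `End_F(V)` is obvious if it is `F · Id` (that is, `⊥`) or the whole `End_F(V)`. -/
def IsObvious (R : Subalgebra F (Module.End F V)) : Prop :=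
  R = ⊥ ∨ R = ⊤

/-- The `G`-module `V` is very simple if every `G`-normal subalgebra of `End_F(V)` is obvious. -/
def IsVerySimple (ρ : Representation F G V) : Prop :=
  ∀ R : Subalgebra F (Module.End F V), IsNormalSubalgebra ρ R → IsObvious R

/-- The `G`-module `V` is central simple if every `G`-normal subalgebra of `End_F(V)` is a central
simple `F`-algebra. -/
def IsCentralSimpleModule (ρ : Representation F G V) : Prop :=
  ∀ R : Subalgebra F (Module.End F V), IsNormalSubalgebra ρ R →
    Algebra.IsCentral F R ∧ IsSimpleRing R

end NormalSubalgebras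

section Heart

variable (F B : Type*) [Field F]

/-- The permutation representation of `Perm(B)` on the space of functions `B → F`:
`(s h)(b) = h(s⁻¹ b)`. -/
def permRep : Representation F (Equiv.Perm B) (B → F) where
  toFun s := LinearMap.funLeft F F (s⁻¹ : Equiv.Perm B)
  map_one' := rfl
  map_mul' s t := by
    ext h b
    simp [LinearMap.funLeft_apply]

/-- The line `F · 1_B` of constant functions. -/
def constLine : Submodule F (B → F) := Submodule.span F {fun _ => 1}

theorem mem_constLine_iff (h : B → F) : h ∈ constLine F B ↔ ∃ c : F, ∀ b, h b = c := by
  simp only [constLine, Submodule.mem_span_singleton, funext_iff, Pi.smul_apply, smul_eq_mul,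
    mul_one, eq_comm]

variable [Fintype B]

/-- The hyperplane `(F^B)^0` of functions with zero sum. -/
def sumZero : Submodule F (B → F) where
  carrier := {h | ∑ b, h b = 0}
  add_mem' {f g} hf hg := by
    simp only [Set.mem_ofPred_eq] at hf hg ⊢
    simp [Finset.sum_add_distrib, hf, hg]
  zero_mem' := by simp
  smul_mem' c f hf := by
    simp only [Set.mem_ofPred_eq] at hf ⊢
    simp [← Finset.mul_sum, hf]

theorem sumZero_invariant (s : Equiv.Perm B) :
    sumZero F B ≤ (sumZero F B).comap (permRep F B s) := by
  intro h hh
  change ∑ b, h ((s⁻¹ : Equiv.Perm B) b) = 0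
  rw [Equiv.sum_comp (s⁻¹ : Equiv.Perm B) h]
  exact hh

/-- The representation of `Perm(B)` on `(F^B)^0`. -/
def sumZeroRep : Representation F (Equiv.Perm B) (sumZero F B) :=
  (permRep F B).subrepresentation (sumZero F B) (sumZero_invariant F B)

/-- The intersection of `F · 1_B` with `(F^B)^0`, as a subspace of `(F^B)^0`. It is `F · 1_B` if
`char F` divides `|B|` and `0` otherwise: see `map_constInSumZero` and `constInSumZero_eq_bot`. -/
def constInSumZero : Submodule F (sumZero F B) :=
  (constLine F B).comap (sumZero F B).subtype

/-- If `|B| = 0` in `F`, then `F · 1_B` is contained in `(F^B)^0`, and `constInSumZero` is that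
line. -/
theorem map_constInSumZero (hB : (Fintype.card B : F) = 0) :
    (constInSumZero F B).map (sumZero F B).subtype = constLine F B := by
  rw [constInSumZero, Submodule.map_comap_subtype, inf_eq_right]
  intro h hh
  obtain ⟨c, hc⟩ := (mem_constLine_iff F B h).1 hh
  change ∑ b, h b = 0
  simp [hc, hB]

/-- If `|B| ≠ 0` in `F`, then `constInSumZero` is zero. -/
theorem constInSumZero_eq_bot (hB : (Fintype.card B : F) ≠ 0) : constInSumZero F B = ⊥ := by
  rw [eq_bot_iff]
  rintro ⟨h, h0⟩ hh
  obtain ⟨c, hc⟩ := (mem_constLine_iff F B h).1 hh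
  change ∑ b, h b = 0 at h0
  have hc0 : c = 0 := by simpa [hc, hB] using h0
  rw [Submodule.mem_bot]
  ext b
  simp [hc, hc0]

theorem constInSumZero_invariant (s : Equiv.Perm B) :
    constInSumZero F B ≤ (constInSumZero F B).comap (sumZeroRep F B s) := by
  intro h hh
  obtain ⟨c, hc⟩ := (mem_constLine_iff F B h).1 hh
  exact (mem_constLine_iff F B _).2 ⟨c, fun b => hc ((s⁻¹ : Equiv.Perm B) b)⟩

/-- The heart `(F^B)^{00}` of the permutation module: the quotient of `(F^B)^0` by its intersection
with `F · 1_B`, i.e. `(F^B)^0 / (F · 1_B)` if `char F` divides `|B|`, and `(F^B)^0` (modulo `0`)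
otherwise. -/
abbrev Heart : Type _ := sumZero F B ⧸ constInSumZero F B

/-- The representation of `Perm(B)` on the heart. -/
def heartRep : Representation F (Equiv.Perm B) (Heart F B) :=
  (sumZeroRep F B).quotient (constInSumZero F B) (constInSumZero_invariant F B)

/-- The restriction of `heartRep` to `Alt(B)`. -/
def heartRepAlt [DecidableEq B] : Representation F (alternatingGroup B) (Heart F B) :=
  (heartRep F B).comp (alternatingGroup B).subtype

end Heart

end HeartModule

namespace HeartModule

section General

variable {F G V : Type*} [Field F] [Group G] [AddCommGroup V] [Module F V]
variable {ρ : Representation F G V} {R : Subalgebra F (Module.End F V)}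

/-- The conjugation action of `G` on a `G`-normal subalgebra. -/
def conjHom (hR : IsNormalSubalgebra ρ R) : G →* (R ≃ₐ[F] R) where
  toFun g :=
    { toFun u := ⟨ρ g * u * ρ g⁻¹, hR g u u.2⟩
      invFun u := ⟨ρ g⁻¹ * u * ρ g, by simpa using hR g⁻¹ u u.2⟩
      left_inv u := by ext v; simp
      right_inv u := by ext v; simp
      map_mul' u v := by ext w; simp
      map_add' u v := by ext w; simp
      commutes' c := by ext w; simp [Module.algebraMap_end_apply] }
  map_one' := by ext u v; simp
  map_mul' g h := by ext u v; simp

theorem conjHom_apply_coe (hR : IsNormalSubalgebra ρ R) (g : G) (u : R) :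
    (conjHom hR g u : Module.End F V) = ρ g * u * ρ g⁻¹ := rfl

theorem rho_smul (hR : IsNormalSubalgebra ρ R) (g : G) (r : R) (v : V) :
    ρ g (r • v) = conjHom hR g r • ρ g v := by
  change ρ g ((r : Module.End F V) v) = (conjHom hR g r : Module.End F V) (ρ g v)
  simp [conjHom_apply_coe]

/-- The image of an `R`-submodule under `ρ g`. -/
def translate (hR : IsNormalSubalgebra ρ R) (g : G) (W : Submodule R V) : Submodule R V where
  carrier := {v | ρ g⁻¹ v ∈ W}
  add_mem' {a b} ha hb := by
    simp only [Set.mem_ofPred_eq] at ha hb ⊢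
    rw [map_add]; exact W.add_mem ha hb
  zero_mem' := by simp
  smul_mem' r v hv := by
    simp only [Set.mem_ofPred_eq] at hv ⊢
    rw [rho_smul hR]; exact W.smul_mem _ hv

variable (hR : IsNormalSubalgebra ρ R)

theorem mem_translate {g : G} {W : Submodule R V} {v : V} :
    v ∈ translate hR g W ↔ ρ g⁻¹ v ∈ W := Iff.rfl

theorem translate_one (W : Submodule R V) : translate hR 1 W = W := by
  ext v; simp [mem_translate]

theorem translate_mul (g h : G) (W : Submodule R V) :
    translate hR (g * h) W = translate hR g (translate hR h W) := by
  ext v; simp [mem_translate]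

theorem rho_mem_translate {g : G} {W : Submodule R V} {v : V} (hv : v ∈ W) :
    ρ g v ∈ translate hR g W := by
  simpa [mem_translate] using hv

/-- Translation by `g` as an automorphism of the lattice of `R`-submodules. -/
def translateIso (g : G) : Submodule R V ≃o Submodule R V where
  toFun := translate hR g
  invFun := translate hR g⁻¹
  left_inv W := by rw [← translate_mul, inv_mul_cancel, translate_one]
  right_inv W := by rw [← translate_mul, mul_inv_cancel, translate_one]
  map_rel_iff' {W W'} := by
    refine ⟨fun h v hv => ?_, fun h v hv => h hv⟩
    have : ρ g v ∈ translate hR g W' := h (rho_mem_translate hR (g := g) hv)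
    simpa [mem_translate] using this

theorem translateIso_apply (g : G) (W : Submodule R V) :
    translateIso hR g W = translate hR g W := rfl

/-- `ρ g` as a linear isomorphism between a submodule and its translate. -/
def translateEquiv (g : G) (W : Submodule R V) : W ≃ₗ[F] translate hR g W where
  toFun w := ⟨ρ g w, rho_mem_translate hR w.2⟩
  invFun w := ⟨ρ g⁻¹ w, w.2⟩
  left_inv w := by ext; simp
  right_inv w := by ext; simp
  map_add' a b := by ext; simp
  map_smul' c a := by ext; simp

theorem translate_linearEquiv (g : G) {W W' : Submodule R V} (e : W ≃ₗ[R] W') :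
    Nonempty (translate hR g W ≃ₗ[R] translate hR g W') := by
  refine ⟨{ ((translateEquiv hR g W).symm.toAddEquiv.trans e.toAddEquiv).trans
    (translateEquiv hR g W').toAddEquiv with map_smul' := fun r w => ?_ }⟩
  ext
  change ρ g (e ⟨ρ g⁻¹ (r • (w : V)), _⟩ : V) = r • ρ g (e ⟨ρ g⁻¹ w, _⟩ : V)
  have h : (⟨ρ g⁻¹ (r • (w : V)), (r • w).2⟩ : W) =
      conjHom hR g⁻¹ r • (⟨ρ g⁻¹ w, w.2⟩ : W) := by
    ext; simp [rho_smul hR]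
  rw [h, map_smul, Submodule.coe_smul, rho_smul hR, ← AlgEquiv.mul_apply, ← map_mul]
  simp

theorem translate_isotypicComponent (g : G) (S : Submodule R V) :
    translate hR g (isotypicComponent R V S) = isotypicComponent R V (translate hR g S) := by
  rw [← translateIso_apply, isotypicComponent, OrderIso.map_sSup_eq_sSup_symm_preimage]
  congr 1
  ext m
  simp only [Set.mem_preimage, Set.mem_ofPred_eq]
  constructor
  · rintro ⟨e⟩
    have := translate_linearEquiv hR g e
    rwa [← translateIso_apply, OrderIso.apply_symm_apply] at this
  · rintro ⟨e⟩
    have := translate_linearEquiv hR g⁻¹ e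
    rwa [← translate_mul, inv_mul_cancel, translate_one] at this

theorem translate_mem_isotypicComponents (g : G) {c : Submodule R V}
    (hc : c ∈ isotypicComponents R V) : translate hR g c ∈ isotypicComponents R V := by
  obtain ⟨S, hS, rfl⟩ := hc
  refine ⟨translate hR g S, ?_, translate_isotypicComponent hR g S⟩
  rw [isSimpleModule_iff_isAtom] at hS ⊢
  exact ((translateIso hR g).isAtom_iff S).2 hS

/-- The permutation action of `G` on the isotypic components of `V`. -/
def isotypicPermHom : G →* Equiv.Perm (isotypicComponents R V) where
  toFun g :=
    { toFun c := ⟨translate hR g c, translate_mem_isotypicComponents hR g c.2⟩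
      invFun c := ⟨translate hR g⁻¹ c, translate_mem_isotypicComponents hR g⁻¹ c.2⟩
      left_inv c := by ext1; simp [← translate_mul, translate_one]
      right_inv c := by ext1; simp [← translate_mul, translate_one] }
  map_one' := by ext1 c; ext1; simp [translate_one]
  map_mul' g h := by ext1 c; ext1; simp [translate_mul]

end General

/-- A ring with a finite faithful isotypic semisimple module is simple. -/
theorem isSimpleRing_of_isIsotypic {A M : Type*} [Ring A] [Nontrivial A] [AddCommGroup M]
    [Finite M] [Module A M] [IsSemisimpleModule A M]
    (hann : ∀ r : A, (∀ v : M, r • v = 0) → r = 0) (hiso : IsIsotypic A M) :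
    IsSimpleRing A := by
  have hss : IsSemisimpleRing A := by
    let f : A →ₗ[A] (M → M) := LinearMap.pi fun v => LinearMap.toSpanSingleton A M v
    refine IsSemisimpleModule.of_injective f ?_
    rw [injective_iff_map_eq_zero]
    exact fun r hr => hann r fun v => congrFun hr v
  have hemb : ∀ m : Submodule A A, IsSimpleModule A m →
      ∃ m' : Submodule A M, Nonempty (m ≃ₗ[A] m') := by
    intro m hm
    have := hm.nontrivial
    obtain ⟨x, hx⟩ := exists_ne (0 : m)
    obtain ⟨v, hv⟩ : ∃ v : M, (x : A) • v ≠ 0 := by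
      by_contra! h
      exact hx (Subtype.ext (hann _ h))
    let f : m →ₗ[A] M := (LinearMap.toSpanSingleton A M v).comp m.subtype
    have hf : f ≠ 0 := fun h => hv (by simpa [f] using LinearMap.congr_fun h x)
    exact ⟨_, ⟨LinearEquiv.ofInjective f (LinearMap.injective_of_ne_zero hf)⟩⟩
  refine (isSimpleRing_isArtinianRing_iff.2 ⟨hss, fun m hm m' hm' => ?_, inferInstance⟩).1
  obtain ⟨n, ⟨e⟩⟩ := hemb m hm
  obtain ⟨n', ⟨e'⟩⟩ := hemb m' hm'
  have hn : IsSimpleModule A n := IsSimpleModule.congr e.symm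
  have hn' : IsSimpleModule A n' := IsSimpleModule.congr e'.symm
  obtain ⟨e''⟩ := hiso n n'
  exact ⟨e'.trans (e''.trans e.symm)⟩

section CentralSimple

variable {F G V : Type*} [Field F] [Group G] [AddCommGroup V] [Module F V]
variable {ρ : Representation F G V} {R : Subalgebra F (Module.End F V)}

/-- The representation `ρ` has no invariant subspaces besides `0` and `V`. -/
def NoInvariantSubspace (ρ : Representation F G V) : Prop :=
  ∀ U : Submodule F V, (∀ g, ∀ v ∈ U, ρ g v ∈ U) → U = ⊥ ∨ U = ⊤

/-- Only the scalars commute with `ρ`. -/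
def OnlyScalarsCommute (ρ : Representation F G V) : Prop :=
  ∀ u : Module.End F V, (∀ g, ρ g * u * ρ g⁻¹ = u) → u ∈ (⊥ : Subalgebra F (Module.End F V))

theorem eq_bot_or_top_of_translate_eq (hirr : NoInvariantSubspace ρ)
    (hR : IsNormalSubalgebra ρ R) {W : Submodule R V} (hW : ∀ g, translate hR g W = W) :
    W = ⊥ ∨ W = ⊤ := by
  refine (hirr (W.restrictScalars F) fun g v hv => ?_).imp (fun h => ?_) (fun h => ?_)
  · have := rho_mem_translate hR (g := g) hv
    rwa [hW] at this
  · simpa using h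
  · simpa using h

theorem eq_bot_or_top_of_translate_eq_of_closure (hirr : NoInvariantSubspace ρ)
    (hR : IsNormalSubalgebra ρ R) {S : Set G} (hS : Subgroup.closure S = ⊤)
    {W : Submodule R V} (hW : ∀ g ∈ S, translate hR g W = W) :
    W = ⊥ ∨ W = ⊤ := by
  refine eq_bot_or_top_of_translate_eq hirr hR fun g => ?_
  induction hS.ge (Subgroup.mem_top g) using Subgroup.closure_induction with
  | mem x hx => exact hW x hx
  | one => exact translate_one hR W
  | mul x y _ _ hx hy => rw [translate_mul, hy, hx]
  | inv x _ hx => nth_rw 1 [← hx]; rw [← translate_mul, inv_mul_cancel, translate_one]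

theorem isSemisimpleModule_of_isNormalSubalgebra (hirr : NoInvariantSubspace ρ)
    (hR : IsNormalSubalgebra ρ R) (W : Submodule R V) [hW : IsSimpleModule R W] :
    IsSemisimpleModule R V := by
  rw [isSimpleModule_iff_isAtom] at hW
  have htop : ⨆ g, translate hR g W = ⊤ := by
    refine (eq_bot_or_top_of_translate_eq hirr hR (fun g => ?_)).resolve_left ?_
    · rw [← translateIso_apply, OrderIso.map_iSup]
      simp only [translateIso_apply, ← translate_mul]
      exact (Equiv.mulLeft g).iSup_comp (g := fun h => translate hR h W)
    · intro h
      have : translate hR 1 W ≤ ⊥ := h ▸ le_iSup (fun g => translate hR g W) 1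
      rw [translate_one] at this
      exact hW.1 (le_bot_iff.1 this)
  refine isSemisimpleModule_of_isSemisimpleModule_submodule' (p := fun g => translate hR g W)
    (fun g => ?_) htop
  have : IsSimpleModule R (translate hR g W) :=
    isSimpleModule_iff_isAtom.2 (((translateIso hR g).isAtom_iff W).2 hW)
  infer_instance

theorem mem_bot_of_conjHom_eq (hscal : OnlyScalarsCommute ρ) (hR : IsNormalSubalgebra ρ R) (r : R)
    (h : ∀ g, conjHom hR g r = r) : r ∈ (⊥ : Subalgebra F R) := by
  obtain ⟨c, hc⟩ := Algebra.mem_bot.1 (hscal r fun g => congrArg Subtype.val (h g))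
  exact Algebra.mem_bot.2 ⟨c, Subtype.ext hc⟩

variable [Finite F] [Module.Finite F V]

theorem finite_subalgebra_end (R : Subalgebra F (Module.End F V)) : Finite R := by
  have := Module.finite_of_finite F (M := Module.End F V)
  infer_instance

theorem exists_isSimpleModule_submodule [Nontrivial V] (R : Subalgebra F (Module.End F V)) :
    ∃ W : Submodule R V, IsSimpleModule R W := by
  have := Module.finite_of_finite F (M := V)
  obtain ⟨W, hW⟩ := IsAtomic.exists_atom (Submodule R V)
  exact ⟨W, isSimpleModule_iff_isAtom.2 hW⟩

theorem isIsotypic_of_isNormalSubalgebra [Nontrivial V] (hirr : NoInvariantSubspace ρ)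
    (hperm : ∀ m ≤ Module.finrank F V, ∀ f : G →* Equiv.Perm (Fin m), f = 1)
    (hR : IsNormalSubalgebra ρ R) : IsSemisimpleModule R V ∧ IsIsotypic R V := by
  have := Module.finite_of_finite F (M := V)
  obtain ⟨W, hW⟩ := exists_isSimpleModule_submodule R
  have hss := isSemisimpleModule_of_isNormalSubalgebra hirr hR W
  refine ⟨hss, ?_⟩
  have hind : iSupIndep fun c : isotypicComponents R V => (c : Submodule R V).restrictScalars F := by
    have h := (sSupIndep_iff _).1 (sSupIndep_isotypicComponents R V)
    rw [iSupIndep_def] at h ⊢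
    intro c
    have hc := h c
    rw [Submodule.disjoint_def] at hc ⊢
    intro x hx hx'
    refine hc x hx ?_
    have hle : (⨆ j, ⨆ (_ : j ≠ c), (j : Submodule R V).restrictScalars F) ≤
        (⨆ j, ⨆ (_ : j ≠ c), (j : Submodule R V)).restrictScalars F :=
      iSup₂_le fun j hj y hy =>
        (le_iSup₂ (f := fun (j : isotypicComponents R V) (_ : j ≠ c) => (j : Submodule R V)) j hj) hy
    exact hle hx'
  have hcard : Nat.card (isotypicComponents R V) ≤ Module.finrank F V := by
    have := Fintype.ofFinite (isotypicComponents R V)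
    have hne : ∀ c : isotypicComponents R V, (c : Submodule R V).restrictScalars F ≠ ⊥ := by
      intro c h
      exact (bot_lt_isotypicComponents c.2).ne' (by simpa using h)
    have h := hind.subtype_ne_bot_le_finrank
    rw [Nat.card_eq_fintype_card]
    refine le_trans (Fintype.card_le_of_injective (fun c => ⟨c, hne c⟩) ?_) h
    intro a b hab
    simpa using hab
  have htriv : isotypicPermHom hR = 1 := by
    have e := Finite.equivFin (isotypicComponents R V)
    have h := hperm _ hcard ((e.permCongrHom : _ →* _).comp (isotypicPermHom hR))
    ext1 g
    have hg : e.permCongrHom (isotypicPermHom hR g) = e.permCongrHom 1 := by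
      rw [map_one]; exact DFunLike.congr_fun h g
    exact e.permCongrHom.injective hg
  have hcomp : isotypicComponent R V W = ⊤ := by
    refine (eq_bot_or_top_of_translate_eq hirr hR (fun g => ?_)).resolve_left
      (bot_lt_isotypicComponent W).ne'
    have := congrArg (fun f => (f g) ⟨isotypicComponent R V W, W, hW, rfl⟩) htriv
    exact congrArg Subtype.val this
  exact (isotypicComponent_eq_top_iff.1 hcomp).isIsotypic

theorem isCentral_of_isSimpleRing (hscal : OnlyScalarsCommute ρ) (hG : commutator G = ⊤)
    (hR : IsNormalSubalgebra ρ R) [IsSimpleRing R] : Algebra.IsCentral F R := by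
  have := finite_subalgebra_end R
  let K := Subalgebra.center F R
  have hK : IsField K := IsSimpleRing.isField_center R
  let : Field K := hK.toField
  let f : G →* (K ≃ₐ[F] K) :=
    { toFun g :=
        { toFun z := ⟨conjHom hR g z, by
            rw [Subalgebra.mem_center_iff]
            intro r
            obtain ⟨r, rfl⟩ := (conjHom hR g).surjective r
            rw [← map_mul, ← map_mul, Subalgebra.mem_center_iff.1 z.2 r]⟩
          invFun z := ⟨conjHom hR g⁻¹ z, by
            rw [Subalgebra.mem_center_iff]
            intro r
            obtain ⟨r, rfl⟩ := (conjHom hR g⁻¹).surjective r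
            rw [← map_mul, ← map_mul, Subalgebra.mem_center_iff.1 z.2 r]⟩
          left_inv z := by ext1; simp
          right_inv z := by ext1; simp
          map_mul' a b := by ext1; simp
          map_add' a b := by ext1; simp
          commutes' c := by ext1; simp }
      map_one' := by ext1 z; ext1; simp
      map_mul' g h := by ext1 z; ext1; simp }
  have hcomm : ∀ a b : K ≃ₐ[F] K, a * b = b * a := by
    have : IsCyclic (K ≃ₐ[F] K) := inferInstance
    exact IsCyclic.isMulCommutative.is_comm.comm
  have hker : f.ker = ⊤ := by
    rw [eq_top_iff, ← hG, commutator_def, Subgroup.commutator_le]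
    intro g _ h _
    rw [MonoidHom.mem_ker, map_commutatorElement, commutatorElement_eq_one_iff_mul_comm]
    exact hcomm _ _
  refine ⟨fun z hz => mem_bot_of_conjHom_eq hscal hR z fun g => ?_⟩
  have hg : g ∈ f.ker := hker ▸ Subgroup.mem_top g
  have := DFunLike.congr_fun ((MonoidHom.mem_ker).1 hg) ⟨z, hz⟩
  exact congrArg Subtype.val this

end CentralSimple

/-- A finite central simple algebra is the full endomorphism algebra of its simple module. -/
theorem lsmul_bijective_of_isSimpleModule {F A W : Type*} [Field F] [Ring A] [Finite A]
    [Algebra F A] [Algebra.IsCentral F A] [IsSimpleRing A] [AddCommGroup W] [Finite W] [Module F W]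
    [Module A W] [IsScalarTower F A W] [IsSimpleModule A W] :
    Function.Bijective (Algebra.lsmul F F W : A →ₐ[F] Module.End F W) := by
  have hW := IsSimpleModule.nontrivial A W
  have hinj : Function.Injective (Algebra.lsmul F F W : A →ₐ[F] Module.End F W) :=
    RingHom.injective (Algebra.lsmul F F W : A →ₐ[F] Module.End F W).toRingHom
  refine ⟨hinj, fun f => ?_⟩
  have hfin : Finite (Module.End A W) := Finite.of_injective _ DFunLike.coe_injective
  have hdom : IsDomain (Module.End A W) := by
    classical exact inferInstance
  have hcomm : ∀ a b : Module.End A W, a * b = b * a := fun a b =>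
    (Finite.isDomain_to_isField (Module.End A W)).mul_comm a b
  have hfinW : Module.Finite (Module.End A W) W := Module.Finite.of_finite
  have hsurj := Module.Finite.toModuleEnd_moduleEnd_surjective (R := A) (M := W)
  have hscal : ∀ d : Module.End A W, ∃ c : F, ∀ w, d w = c • w := by
    intro d
    obtain ⟨r, hr⟩ := hsurj
      { toFun := d, map_add' := map_add d,
        map_smul' := fun e w => by
          change (d * e) w = (e * d) w
          rw [hcomm] }
    have hr' : ∀ w, r • w = d w := fun w => LinearMap.congr_fun hr w
    have hcen : r ∈ Subalgebra.center F A := by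
      rw [Subalgebra.mem_center_iff]
      intro b
      apply hinj
      ext w
      simp [hr']
    obtain ⟨c, rfl⟩ := Algebra.mem_bot.1 (Algebra.IsCentral.out hcen)
    exact ⟨c, fun w => by rw [← hr', algebraMap_smul]⟩
  obtain ⟨r, hr⟩ := hsurj
    { toFun := f, map_add' := map_add f,
      map_smul' := fun e w => by
        obtain ⟨c, hc⟩ := hscal e
        simp [hc] }
  exact ⟨r, LinearMap.ext fun w => LinearMap.congr_fun hr w⟩

section RankArguments

variable {F G V : Type*} [Field F] [Group G] [AddCommGroup V] [Module F V]
variable {ρ : Representation F G V} {R : Subalgebra F (Module.End F V)}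
variable (hR : IsNormalSubalgebra ρ R)

theorem disjoint_translate {W : Submodule R V} [hW : IsSimpleModule R W] {s : G}
    (hs : translate hR s W ≠ W) : Disjoint W (translate hR s W) := by
  rw [isSimpleModule_iff_isAtom] at hW
  have hW' : IsAtom (translate hR s W) := ((translateIso hR s).isAtom_iff W).2 hW
  exact hW.disjoint_of_ne hW' hs.symm

theorem rho_sub_one_domRestrict_injective {W : Submodule R V} [hW : IsSimpleModule R W] {s : G}
    (hs : translate hR s W ≠ W) :
    Function.Injective ((ρ s - 1).domRestrict (W.restrictScalars F)) := by
  rw [injective_iff_map_eq_zero]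
  rintro ⟨w, hw⟩ h
  have h' : ρ s w = w := sub_eq_zero.1 (by simpa using h)
  have hw' : w ∈ translate hR s W := h' ▸ rho_mem_translate hR hw
  exact Subtype.ext ((Submodule.disjoint_def.1 (disjoint_translate hR hs)) w hw hw')

theorem conjHom_eq_one_of_range_le [IsSimpleRing R] {s : G} {U : Submodule R V} (hU : U ≠ ⊤)
    (hs : ∀ v, ρ s v - v ∈ U) : conjHom hR s = 1 := by
  have hnt : Nontrivial (V ⧸ U) := Submodule.Quotient.nontrivial_iff.2 hU
  have hnt' : Nontrivial (AddMonoid.End (V ⧸ U)) := by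
    obtain ⟨x, hx⟩ := exists_ne (0 : V ⧸ U)
    exact ⟨1, 0, fun h => hx (DFunLike.congr_fun h x)⟩
  have hinj : Function.Injective (Module.toAddMonoidEnd R (V ⧸ U)) := RingHom.injective _
  ext1 r
  apply hinj
  ext x
  obtain ⟨v, rfl⟩ := U.mkQ_surjective x
  change conjHom hR s r • U.mkQ v = r • U.mkQ v
  rw [← map_smul, ← map_smul, Submodule.mkQ_apply, Submodule.mkQ_apply, Submodule.Quotient.eq]
  have h1 : conjHom hR s r • v = conjHom hR s r • ρ s v - conjHom hR s r • (ρ s v - v) := by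
    rw [smul_sub]; abel
  rw [h1, ← rho_smul hR]
  have h2 := U.sub_mem (hs (r • v)) (U.smul_mem (conjHom hR s r) (hs v))
  convert h2 using 1
  abel

variable [Module.Finite F V]

theorem finrank_le_of_translate_ne {W : Submodule R V} [hW : IsSimpleModule R W] {s : G}
    (hs : translate hR s W ≠ W) :
    Module.finrank F W ≤ Module.finrank F (LinearMap.range (ρ s - 1)) := by
  have h := LinearMap.finrank_range_of_inj (rho_sub_one_domRestrict_injective hR hs)
  change _ = Module.finrank F W at h
  rw [← h]
  refine Submodule.finrank_mono ?_
  rintro _ ⟨w, rfl⟩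
  exact ⟨w, rfl⟩

theorem finrank_eq_two_mul_of_translate_ne [IsSimpleRing R] {W : Submodule R V}
    [hW : IsSimpleModule R W] {s : G} (hs : translate hR s W ≠ W) (hs1 : conjHom hR s ≠ 1)
    (hrank : Module.finrank F (LinearMap.range (ρ s - 1)) ≤ Module.finrank F W) :
    Module.finrank F V = 2 * Module.finrank F W := by
  have hrange : LinearMap.range ((ρ s - 1).domRestrict (W.restrictScalars F)) =
      LinearMap.range (ρ s - 1) := by
    refine Submodule.eq_of_le_of_finrank_le ?_ ?_
    · rintro _ ⟨w, rfl⟩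
      exact ⟨w, rfl⟩
    · rw [LinearMap.finrank_range_of_inj (rho_sub_one_domRestrict_injective hR hs)]
      exact hrank
  have htop : W ⊔ translate hR s W = ⊤ := by
    by_contra hU
    refine hs1 (conjHom_eq_one_of_range_le hR hU fun v => ?_)
    have hv : (ρ s - 1) v ∈ LinearMap.range ((ρ s - 1).domRestrict (W.restrictScalars F)) :=
      hrange ▸ ⟨v, rfl⟩
    obtain ⟨⟨w, hw⟩, hwv⟩ := hv
    have hwv' : ρ s w - w = ρ s v - v := hwv
    rw [← hwv']
    exact Submodule.sub_mem _ (Submodule.mem_sup_right (rho_mem_translate hR hw))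
      (Submodule.mem_sup_left hw)
  have hdisj := disjoint_translate hR hs
  have hcompl : IsCompl (W.restrictScalars F) ((translate hR s W).restrictScalars F) := by
    refine IsCompl.of_eq ?_ ?_
    · rw [eq_bot_iff]
      rintro x ⟨hx, hx'⟩
      exact Submodule.disjoint_def.1 hdisj x hx hx'
    · rw [eq_top_iff]
      intro x _
      obtain ⟨a, ha, b, hb, rfl⟩ := Submodule.mem_sup.1 (htop.ge (Submodule.mem_top (x := x)))
      exact Submodule.add_mem_sup (S := W.restrictScalars F) ha hb
  have h := Submodule.finrank_add_eq_of_isCompl hcompl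
  have h' : Module.finrank F ((translate hR s W).restrictScalars F) =
      Module.finrank F (W.restrictScalars F) := (translateEquiv hR s W).finrank_eq.symm
  rw [h'] at h
  rw [← h, two_mul]
  rfl

end RankArguments

section PrimeOrderAutomorphisms

theorem pow_card_sub_one_eq_one_of_apply_eq_smul {F W : Type*} [Field F] [Fintype F] [AddCommGroup W]
    [Module F W] [Nontrivial W] (T : W ≃ₗ[F] W) (c : F) (hT : ∀ w, T w = c • w) :
    T ^ (Fintype.card F - 1) = 1 := by
  have hc : c ≠ 0 := by
    rintro rfl
    obtain ⟨w, hw⟩ := exists_ne (0 : W)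
    exact hw (T.injective (by simp [hT]))
  have hpow : ∀ k : ℕ, ∀ w, (T ^ k) w = c ^ k • w := by
    intro k
    induction k with
    | zero => simp
    | succ k ih => intro w; rw [pow_succ, LinearEquiv.mul_apply, ih, hT, smul_smul, pow_succ]
  ext w
  rw [hpow, FiniteField.pow_card_sub_one_eq_one c hc]
  simp

/-- A nontrivial automorphism of order `ℓ` of `Mat₂(F_q)` forces `ℓ ∣ q (q² - 1)`. -/
theorem prime_dvd_of_pow_eq_one {F : Type*} [Field F] [Fintype F] {ℓ : ℕ} (hℓ : ℓ.Prime)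
    (α : Module.End F (Fin 2 → F) ≃ₐ[F] Module.End F (Fin 2 → F)) (h5 : α ^ ℓ = 1) (h1 : α ≠ 1) :
    ℓ ∣ Fintype.card F * (Fintype.card F ^ 2 - 1) := by
  classical
  obtain ⟨T, rfl⟩ := α.eq_linearEquivConjAlgEquiv
  let f : ((Fin 2 → F) ≃ₗ[F] (Fin 2 → F)) →*
      (Module.End F (Fin 2 → F) ≃ₐ[F] Module.End F (Fin 2 → F)) :=
    { toFun T := T.conjAlgEquiv F
      map_one' := by ext; rfl
      map_mul' S T := by ext; rfl }
  change f T ^ ℓ = 1 at h5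
  change f T ≠ 1 at h1
  have hscal : ∃ c : F, ∀ w, (T ^ ℓ) w = c • w := by
    have hcomm : ((T ^ ℓ : (Fin 2 → F) ≃ₗ[F] (Fin 2 → F)) : Module.End F (Fin 2 → F)) ∈
        Subalgebra.center F (Module.End F (Fin 2 → F)) := by
      rw [Subalgebra.mem_center_iff]
      intro A
      have h := DFunLike.congr_fun ((map_pow f T ℓ).trans h5) A
      refine LinearMap.ext fun w => ?_
      have hw := LinearMap.congr_fun h ((T ^ ℓ) w)
      simpa [f, LinearEquiv.conjAlgEquiv_apply] using hw.symm
    obtain ⟨c, hc⟩ := Algebra.mem_bot.1 (Algebra.IsCentral.out hcomm)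
    exact ⟨c, fun w => by
      have := LinearMap.congr_fun hc w
      simpa [Module.algebraMap_end_apply] using this.symm⟩
  obtain ⟨c, hc⟩ := hscal
  have hT := pow_card_sub_one_eq_one_of_apply_eq_smul (T ^ ℓ) c hc
  have hcard : Nat.card ((Fin 2 → F) ≃ₗ[F] (Fin 2 → F)) =
      (Fintype.card F ^ 2 - 1) * (Fintype.card F ^ 2 - Fintype.card F) := by
    rw [← Nat.card_congr (LinearMap.GeneralLinearGroup.generalLinearEquiv F (Fin 2 → F)).toEquiv,
      ← Nat.card_congr (Matrix.GeneralLinearGroup.toLin (n := Fin 2) (R := F)).toEquiv,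
      Matrix.card_GL_field]
    simp [Fin.prod_univ_two]
  by_contra hndvd
  set q := Fintype.card F
  have hq : 1 < q := Fintype.one_lt_card
  have hndvd' : ¬ ℓ ∣ Nat.card ((Fin 2 → F) ≃ₗ[F] (Fin 2 → F)) := by
    rw [hcard]
    intro h
    rcases hℓ.dvd_mul.1 h with h | h
    · exact hndvd (Dvd.dvd.mul_left h _)
    · have hq2 : q ^ 2 - q = q * (q - 1) := by rw [Nat.mul_sub, sq, mul_one]
      rw [hq2] at h
      refine hndvd (h.trans (mul_dvd_mul_left _ ⟨q + 1, ?_⟩))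
      rw [mul_comm]
      simpa using Nat.sq_sub_sq q 1
  have hT1 : T ^ (q - 1) = 1 := by
    have h1' : (T ^ (q - 1)) ^ ℓ = 1 := by rw [← pow_mul, mul_comm, pow_mul, hT]
    rcases (Nat.dvd_prime hℓ).1 (orderOf_dvd_of_pow_eq_one h1') with h | h
    · exact orderOf_eq_one_iff.1 h
    · exact absurd (h ▸ orderOf_dvd_natCard _) hndvd'
  have hf1 : f T ^ (q - 1) = 1 := by rw [← map_pow, hT1, map_one]
  refine h1 (orderOf_eq_one_iff.1 ?_)
  rcases (Nat.dvd_prime hℓ).1 (orderOf_dvd_of_pow_eq_one h5) with h | h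
  · exact h
  · refine absurd ?_ hndvd
    have h2 : ℓ ∣ q - 1 := h ▸ orderOf_dvd_of_pow_eq_one hf1
    refine Dvd.dvd.mul_left (h2.trans ⟨q + 1, ?_⟩) _
    rw [mul_comm]
    simpa using Nat.sq_sub_sq q 1

end PrimeOrderAutomorphisms

section Classification

variable {F G V : Type*} [Field F] [Group G] [AddCommGroup V] [Module F V]
variable {ρ : Representation F G V} {R : Subalgebra F (Module.End F V)}

/-- The natural module `V` of `R` has a simple submodule of dimension two. -/
def HasSimplePlane (R : Subalgebra F (Module.End F V)) : Prop :=
  ∃ W : Submodule R V, IsSimpleModule R W ∧ Module.finrank F W = 2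

theorem not_hasSimplePlane [Module.Finite F V] (hirr : NoInvariantSubspace ρ)
    {S : Set G} (hS : Subgroup.closure S = ⊤)
    (hrank : ∀ s ∈ S, Module.finrank F (LinearMap.range (ρ s - 1)) ≤ 1)
    (hV : Module.finrank F V ≠ 2) (hR : IsNormalSubalgebra ρ R) : ¬ HasSimplePlane R := by
  rintro ⟨W, hW, hW2⟩
  have hst : ∀ s ∈ S, translate hR s W = W := fun s hs => by
    by_contra hne
    have h1 := finrank_le_of_translate_ne hR hne
    have h2 := hrank s hs
    omega
  rcases eq_bot_or_top_of_translate_eq_of_closure hirr hR hS hst with h | h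
  · exact (isSimpleModule_iff_isAtom.1 hW).1 h
  · have hWV : Module.finrank F (W.restrictScalars F) = Module.finrank F V := by
      rw [h, Submodule.restrictScalars_top, finrank_top]
    exact hV (hWV.symm.trans hW2)

theorem conjHom_injective_of_ne_bot [IsSimpleGroup G] (hscal : OnlyScalarsCommute ρ)
    (hR : IsNormalSubalgebra ρ R) (hbot : R ≠ ⊥) : Function.Injective (conjHom hR) := by
  rw [← MonoidHom.ker_eq_bot_iff]
  refine (IsSimpleGroup.eq_bot_or_eq_top_of_normal _ inferInstance).resolve_right fun h => hbot ?_
  rw [eq_bot_iff]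
  intro r hr
  refine hscal r fun g => ?_
  have hg : g ∈ (conjHom hR).ker := h ▸ Subgroup.mem_top g
  exact congrArg Subtype.val (DFunLike.congr_fun (MonoidHom.mem_ker.1 hg) ⟨r, hr⟩)

variable [Fintype F] [Module.Finite F V]

theorem isSimpleRing_of_isNormalSubalgebra [Nontrivial V] (hirr : NoInvariantSubspace ρ)
    (hperm : ∀ m ≤ Module.finrank F V, ∀ f : G →* Equiv.Perm (Fin m), f = 1)
    (hR : IsNormalSubalgebra ρ R) : IsSimpleRing R := by
  have := Module.finite_of_finite F (M := V)
  obtain ⟨_, hiso⟩ := isIsotypic_of_isNormalSubalgebra hirr hperm hR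
  exact isSimpleRing_of_isIsotypic (fun r h => by ext v; exact h v) hiso

/-- The algebra isomorphism between a central simple subalgebra of `End_F(V)` and the endomorphism
algebra of a simple submodule of `V`. -/
noncomputable def algEquivEnd [IsSimpleRing R] [Algebra.IsCentral F R] (W : Submodule R V)
    [IsSimpleModule R W] : R ≃ₐ[F] Module.End F W :=
  have := finite_subalgebra_end R
  have := Module.finite_of_finite F (M := V)
  AlgEquiv.ofBijective _ (lsmul_bijective_of_isSimpleModule (F := F) (A := R) (W := W))

theorem finrank_eq_sq [IsSimpleRing R] [Algebra.IsCentral F R] (W : Submodule R V)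
    [IsSimpleModule R W] : Module.finrank F R = Module.finrank F W ^ 2 := by
  have : Module.Finite F W := inferInstanceAs (Module.Finite F (W.restrictScalars F))
  have : Module.Free F W := inferInstanceAs (Module.Free F (W.restrictScalars F))
  rw [(algEquivEnd W).toLinearEquiv.finrank_eq]
  exact (Module.finrank_linearMap F F W W).trans (sq _).symm

theorem eq_bot_or_top_or_of_isNormalSubalgebra [Nontrivial V] [IsSimpleGroup G]
    (hirr : NoInvariantSubspace ρ) (hscal : OnlyScalarsCommute ρ)
    {S : Set G} (hS : Subgroup.closure S = ⊤)
    (hrank : ∀ s ∈ S, Module.finrank F (LinearMap.range (ρ s - 1)) ≤ 2)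
    {ℓ : ℕ} (hℓ : ℓ.Prime) {g : G} (hg1 : g ≠ 1) (hg : g ^ ℓ = 1)
    (hR : IsNormalSubalgebra ρ R) [IsSimpleRing R] [Algebra.IsCentral F R] :
    R = ⊥ ∨ R = ⊤ ∨ (Module.finrank F V = 4 ∧
      ℓ ∣ Fintype.card F * (Fintype.card F ^ 2 - 1) ∧
      Nonempty (R ≃ₐ[F] Matrix (Fin 2) (Fin 2) F) ∧
      HasSimplePlane R) := by
  obtain ⟨W, hW⟩ := exists_isSimpleModule_submodule R
  have hfin : Module.Finite F W := inferInstanceAs (Module.Finite F (W.restrictScalars F))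
  have hfree : Module.Free F W := inferInstanceAs (Module.Free F (W.restrictScalars F))
  have hRW := finrank_eq_sq W
  by_cases hbot : R = ⊥
  · exact Or.inl hbot
  refine Or.inr ?_
  have hinj := conjHom_injective_of_ne_bot hscal hR hbot
  by_cases hst : ∀ s ∈ S, translate hR s W = W
  · left
    rcases eq_bot_or_top_of_translate_eq_of_closure hirr hR hS hst with h | h
    · exact absurd h (isSimpleModule_iff_isAtom.1 hW).1
    · have hWV : Module.finrank F W = Module.finrank F V := by
        change Module.finrank F (W.restrictScalars F) = _
        rw [h, Submodule.restrictScalars_top, finrank_top]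
      rw [← Algebra.toSubmodule_eq_top]
      apply Submodule.eq_top_of_finrank_eq
      change Module.finrank F R = _
      rw [hRW, hWV, Module.finrank_linearMap, sq]
  · right
    push Not at hst
    obtain ⟨s, hsS, hs⟩ := hst
    have hle := (finrank_le_of_translate_ne hR hs).trans (hrank s hsS)
    have hW2 : Module.finrank F W = 2 := by
      have h0 : Module.finrank F W ≠ 0 := by
        have := IsSimpleModule.nontrivial R W
        exact (Module.finrank_pos (R := F) (M := W)).ne'
      have h1 : Module.finrank F W ≠ 1 := fun h =>
        hbot (Subalgebra.eq_bot_of_finrank_one (by rw [hRW, h, one_pow]))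
      omega
    have hs1 : conjHom hR s ≠ 1 := fun h => by
      have : s = 1 := hinj (h.trans (map_one _).symm)
      exact hs (this ▸ translate_one hR W)
    have e : W ≃ₗ[F] (Fin 2 → F) := LinearEquiv.ofFinrankEq _ _ (by simp [hW2])
    have E : R ≃ₐ[F] Module.End F (Fin 2 → F) := (algEquivEnd W).trans (e.conjAlgEquiv F)
    refine ⟨?_, ?_, ⟨E.trans LinearMap.toMatrixAlgEquiv'⟩, W, hW, hW2⟩
    · rw [finrank_eq_two_mul_of_translate_ne hR hs hs1 ((hrank s hsS).trans hW2.ge), hW2]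
    · let E' : (R ≃ₐ[F] R) ≃* (Module.End F (Fin 2 → F) ≃ₐ[F] Module.End F (Fin 2 → F)) :=
        AlgEquiv.autCongr E
      refine prime_dvd_of_pow_eq_one hℓ (E' (conjHom hR g)) ?_ fun h => hg1 ?_
      · rw [← map_pow, ← map_pow, hg, map_one, map_one]
      · exact hinj (E'.injective (by rw [h, map_one, map_one]))

end Classification

section HeartBasics

variable {F B : Type*} [Field F] [Fintype B]

variable (F B) in
/-- The class in the heart of a function with zero sum. -/
def heartMk : sumZero F B →ₗ[F] Heart F B := (constInSumZero F B).mkQ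

theorem heartMk_surjective : Function.Surjective (heartMk F B) :=
  Submodule.mkQ_surjective _

theorem heartMk_eq_iff {h k : sumZero F B} :
    heartMk F B h = heartMk F B k ↔ ∃ c : F, ∀ b, (h : B → F) b - (k : B → F) b = c := by
  rw [heartMk, Submodule.mkQ_apply, Submodule.mkQ_apply, Submodule.Quotient.eq]
  exact mem_constLine_iff F B _

theorem sum_eq_zero_of_sumZero (h : sumZero F B) : ∑ b, (h : B → F) b = 0 := h.2

theorem heartRep_heartMk (s : Equiv.Perm B) (h : sumZero F B) :
    heartRep F B s (heartMk F B h) = heartMk F B (sumZeroRep F B s h) := rfl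

theorem sumZeroRep_apply (s : Equiv.Perm B) (h : sumZero F B) (b : B) :
    (sumZeroRep F B s h : B → F) b = (h : B → F) (s⁻¹ b) := rfl

/-- The functions with zero sum that vanish outside `T`. -/
def supportedIn (F : Type*) {B : Type*} [Field F] [Fintype B] (T : Finset B) :
    Submodule F (sumZero F B) where
  carrier := {h | ∀ b ∉ T, (h : B → F) b = 0}
  add_mem' {f g} hf hg b hb := by simp [hf b hb, hg b hb]
  zero_mem' b _ := rfl
  smul_mem' c f hf b hb := by simp [hf b hb]

theorem finrank_supportedIn_le [DecidableEq B] {T : Finset B} (hT : T.Nonempty) :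
    Module.finrank F (supportedIn F T) ≤ T.card - 1 := by
  obtain ⟨t, ht⟩ := hT
  let f : supportedIn F T →ₗ[F] (T.erase t → F) :=
    { toFun h x := (h : B → F) x
      map_add' _ _ := rfl
      map_smul' _ _ := rfl }
  have hf : Function.Injective f := by
    rw [injective_iff_map_eq_zero]
    intro h hh
    have h0 : ∀ b, b ≠ t → ((h : sumZero F B) : B → F) b = 0 := by
      intro b hb
      by_cases hbT : b ∈ T
      · exact congrFun hh ⟨b, Finset.mem_erase.2 ⟨hb, hbT⟩⟩
      · exact h.2 b hbT
    have hs := sum_eq_zero_of_sumZero (h : sumZero F B)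
    rw [Finset.sum_eq_single t (fun b _ hb => h0 b hb) (by simp)] at hs
    ext b
    by_cases hb : b = t
    · rw [hb]; exact hs
    · exact h0 b hb
  refine (LinearMap.finrank_le_finrank_of_injective hf).trans ?_
  rw [Module.finrank_fintype_fun_eq_card, Fintype.card_coe, Finset.card_erase_of_mem ht]

theorem sumZeroRep_sub_mem_supportedIn [DecidableEq B] (s : Equiv.Perm B) (h : sumZero F B) :
    sumZeroRep F B s h - h ∈ supportedIn F s.support := by
  intro b hb
  have hb' : s⁻¹ b = b := by
    rw [Equiv.Perm.inv_eq_iff_eq]; exact (Equiv.Perm.notMem_support.1 hb).symm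
  change (h : B → F) (s⁻¹ b) - (h : B → F) b = 0
  rw [hb', sub_self]

theorem range_heartRep_sub_one_le [DecidableEq B] (s : Equiv.Perm B) :
    LinearMap.range (heartRep F B s - 1) ≤ (supportedIn F s.support).map (heartMk F B) := by
  rintro _ ⟨x, rfl⟩
  obtain ⟨h, rfl⟩ := heartMk_surjective x
  exact ⟨_, sumZeroRep_sub_mem_supportedIn s h, by simp [heartRep_heartMk]⟩

theorem finrank_range_heartRep_sub_one_le [DecidableEq B] {s : Equiv.Perm B} (hs : s ≠ 1) :
    Module.finrank F (LinearMap.range (heartRep F B s - 1)) ≤ s.support.card - 1 :=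
  ((Submodule.finrank_mono (range_heartRep_sub_one_le s)).trans
    (Submodule.finrank_map_le _ _)).trans
    (finrank_supportedIn_le (Finset.nonempty_iff_ne_empty.2 (by simpa using hs)))

/-- The difference of the indicator functions of `a` and `b`. -/
def edgeFun (F : Type*) {B : Type*} [Field F] [Fintype B] [DecidableEq B] (a b : B) :
    sumZero F B :=
  ⟨Pi.single a 1 - Pi.single b 1, by
    change ∑ x, (Pi.single a (1 : F) - Pi.single b (1 : F) : B → F) x = 0
    simp⟩

variable [DecidableEq B]

theorem edgeFun_apply (a b x : B) :
    (edgeFun F a b : B → F) x = (if x = a then 1 else 0) - (if x = b then 1 else 0) := by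
  simp [edgeFun, Pi.single_apply]

theorem sumZeroRep_edgeFun (s : Equiv.Perm B) (a b : B) :
    sumZeroRep F B s (edgeFun F a b) = edgeFun F (s a) (s b) := by
  ext x
  simp only [sumZeroRep_apply, edgeFun_apply, Equiv.Perm.inv_eq_iff_eq]

theorem heartRep_edge (s : Equiv.Perm B) (a b : B) :
    heartRep F B s (heartMk F B (edgeFun F a b)) = heartMk F B (edgeFun F (s a) (s b)) := by
  rw [heartRep_heartMk, sumZeroRep_edgeFun]

theorem eq_top_of_edge_mem [Nonempty B] {U : Submodule F (Heart F B)}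
    (hU : ∀ a b, a ≠ b → heartMk F B (edgeFun F a b) ∈ U) : U = ⊤ := by
  rw [eq_top_iff]
  intro x _
  obtain ⟨h, rfl⟩ := heartMk_surjective x
  let b₀ := Classical.arbitrary B
  have hh : h = ∑ b, (h : B → F) b • edgeFun F b b₀ := by
    ext x
    simp [edgeFun_apply, mul_sub, sum_eq_zero_of_sumZero]
  rw [hh, map_sum]
  refine U.sum_mem fun b _ => ?_
  rw [map_smul]
  by_cases hb : b = b₀
  · have : edgeFun F b b₀ = 0 := by ext; simp [edgeFun_apply, hb]
    simp [this]
  · exact U.smul_mem _ (hU _ _ hb)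

/-- The even permutation mapping `a` to `b`, `b` to `c` and `c` to `a`. -/
def threeCycle (a b c : B) (hab : a ≠ b) (hbc : b ≠ c) : alternatingGroup B :=
  ⟨Equiv.swap a b * Equiv.swap b c, by
    simp [Equiv.Perm.mem_alternatingGroup, Equiv.Perm.sign_swap hab, Equiv.Perm.sign_swap hbc]⟩

theorem coe_threeCycle (a b c : B) (hab : a ≠ b) (hbc : b ≠ c) :
    (threeCycle a b c hab hbc : Equiv.Perm B) = Equiv.swap a b * Equiv.swap b c := rfl

theorem sub_threeCycle_apply {a b c : B} (hab : a ≠ b) (hbc : b ≠ c) (hac : a ≠ c)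
    (h : sumZero F B) (x : B) :
    ((h - sumZeroRep F B (threeCycle a b c hab hbc) h : sumZero F B) : B → F) x =
      if x = a then (h : B → F) a - (h : B → F) c else
      if x = b then (h : B → F) b - (h : B → F) a else
      if x = c then (h : B → F) c - (h : B → F) b else 0 := by
  change (h : B → F) x - (h : B → F) ((Equiv.swap a b * Equiv.swap b c)⁻¹ x) = _
  simp only [mul_inv_rev, Equiv.swap_inv, Equiv.Perm.mul_apply]
  split_ifs with h1 h2 h3
  · subst h1; simp
  · subst h2; rw [Equiv.swap_apply_right, Equiv.swap_apply_of_ne_of_ne hab hac]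
  · subst h3; rw [Equiv.swap_apply_of_ne_of_ne hac.symm hbc.symm, Equiv.swap_apply_right]
  · rw [Equiv.swap_apply_of_ne_of_ne h1 h2, Equiv.swap_apply_of_ne_of_ne h2 h3, sub_self]

theorem exists_alternatingGroup_apply_eq (hB : 5 ≤ Fintype.card B) {a b i j : B} (hab : a ≠ b)
    (hij : i ≠ j) :
    ∃ g : alternatingGroup B, (g : Equiv.Perm B) a = i ∧ (g : Equiv.Perm B) b = j := by
  have h := alternatingGroup.isMultiplyPretransitive B
  have h2 : MulAction.IsMultiplyPretransitive (alternatingGroup B) B 2 :=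
    MulAction.isMultiplyPretransitive_of_le (n := Nat.card B - 2)
      (by rw [Nat.card_eq_fintype_card]; omega) (by simp)
  exact MulAction.is_two_pretransitive_iff.1 h2 hab hij

theorem exists_notMem_of_card_lt (T : Finset B) (hT : T.card < Fintype.card B) :
    ∃ b, b ∉ T := by
  by_contra! h
  exact hT.ne (by rw [Finset.eq_univ_iff_forall.2 h, Finset.card_univ])

theorem noInvariantSubspace_heartRepAlt (hB : 5 ≤ Fintype.card B) :
    NoInvariantSubspace (heartRepAlt F B) := by
  intro U hU
  have hne : Nonempty B := Fintype.card_pos_iff.1 (by omega)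
  refine or_iff_not_imp_left.2 fun hbot => ?_
  obtain ⟨x, hxU, hx⟩ := U.exists_mem_ne_zero_of_ne_bot hbot
  obtain ⟨h, rfl⟩ := heartMk_surjective x
  have hsub : ∀ (g : alternatingGroup B) (k : sumZero F B), heartMk F B k ∈ U →
      heartMk F B (k - sumZeroRep F B g k) ∈ U := fun g k hk => by
    rw [map_sub]; exact U.sub_mem hk (hU g _ hk)
  obtain ⟨a, b, hab⟩ : ∃ a b, (h : B → F) a ≠ (h : B → F) b := by
    by_contra! hc
    refine hx ?_
    rw [← map_zero (heartMk F B), heartMk_eq_iff]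
    exact ⟨(h : B → F) (Classical.arbitrary B), fun b => by simp [hc b (Classical.arbitrary B)]⟩
  have hab' : a ≠ b := fun h => hab (h ▸ rfl)
  obtain ⟨c, hc⟩ := exists_notMem_of_card_lt {a, b} (Finset.card_le_two.trans_lt (by omega))
  obtain ⟨d, hd⟩ := exists_notMem_of_card_lt {a, b, c} (Finset.card_le_three.trans_lt (by omega))
  obtain ⟨e, he⟩ := exists_notMem_of_card_lt {a, b, c, d} (Finset.card_le_four.trans_lt (by omega))
  simp only [Finset.mem_insert, Finset.mem_singleton, not_or] at hc hd he
  have hk := hsub (threeCycle a b c hab' (Ne.symm hc.2)) h hxU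
  set k := h - sumZeroRep F B (threeCycle a b c hab' (Ne.symm hc.2)) h with hkdef
  have hkx := sub_threeCycle_apply hab' (Ne.symm hc.2) (Ne.symm hc.1) h
  rw [← hkdef] at hkx
  have hk' := hsub (threeCycle b d e (Ne.symm hd.2.1) (Ne.symm he.2.2.2)) k hk
  have hedge : k - sumZeroRep F B (threeCycle b d e (Ne.symm hd.2.1) (Ne.symm he.2.2.2)) k =
      ((h : B → F) b - (h : B → F) a) • edgeFun F b d := by
    ext x
    rw [sub_threeCycle_apply (Ne.symm hd.2.1) (Ne.symm he.2.2.2) (Ne.symm he.2.1)]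
    have hkb : (k : B → F) b = (h : B → F) b - (h : B → F) a := by
      rw [hkx, if_neg hab'.symm, if_pos rfl]
    have hkd : (k : B → F) d = 0 := by
      rw [hkx, if_neg hd.1, if_neg hd.2.1, if_neg hd.2.2]
    have hke : (k : B → F) e = 0 := by
      rw [hkx, if_neg he.1, if_neg he.2.1, if_neg he.2.2.1]
    rw [hkb, hkd, hke]
    simp only [SetLike.val_smul, Pi.smul_apply, edgeFun_apply, smul_eq_mul]
    split_ifs with h1 h2 h3 <;> simp_all
  rw [hedge, map_smul, U.smul_mem_iff (sub_ne_zero.2 hab.symm)] at hk'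
  refine eq_top_of_edge_mem fun i j hij => ?_
  obtain ⟨g, rfl, rfl⟩ := exists_alternatingGroup_apply_eq hB (Ne.symm hd.2.1) hij
  rw [← heartRep_edge]
  exact hU g _ hk'

theorem heartMk_supportedIn_inf_le (hB : 5 ≤ Fintype.card B) {a b c d : B}
    (hcd : c ≠ d) {x : Heart F B}
    (h₁ : x ∈ (supportedIn F {a, b, c}).map (heartMk F B))
    (h₂ : x ∈ (supportedIn F {a, b, d}).map (heartMk F B)) :
    x ∈ (supportedIn F {a, b}).map (heartMk F B) := by
  obtain ⟨h, hh, rfl⟩ := h₁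
  obtain ⟨k, hk, hkh⟩ := h₂
  obtain ⟨e, he⟩ := exists_notMem_of_card_lt {a, b, c, d} (Finset.card_le_four.trans_lt (by omega))
  simp only [Finset.mem_insert, Finset.mem_singleton, not_or] at he
  obtain ⟨z, hz⟩ := heartMk_eq_iff.1 hkh
  have hz0 : z = 0 := by
    rw [← hz e, hh e (by simp [he]), hk e (by simp [he]), sub_zero]
  refine ⟨h, fun x hx => ?_, rfl⟩
  simp only [Finset.mem_insert, Finset.mem_singleton, not_or] at hx
  by_cases hxc : x = c
  · have h1 := hz x
    rw [hk x (by simp [hxc, hcd]; simpa [hxc] using hx), hz0] at h1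
    simpa using h1
  · exact hh x (by simp [hx, hxc])

theorem exists_smul_edge_of_mem {a b : B} (hab : a ≠ b) {x : Heart F B}
    (h : x ∈ (supportedIn F {a, b}).map (heartMk F B)) :
    ∃ c : F, x = c • heartMk F B (edgeFun F a b) := by
  obtain ⟨h, hh, rfl⟩ := h
  refine ⟨(h : B → F) a, ?_⟩
  rw [← map_smul]
  congr 1
  have hs := sum_eq_zero_of_sumZero h
  rw [← Finset.sum_subset (Finset.subset_univ {a, b}) (fun x _ hx => hh x hx),
    Finset.sum_pair hab] at hs
  ext x
  simp only [SetLike.val_smul, Pi.smul_apply, edgeFun_apply, smul_eq_mul]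
  split_ifs with h1 h2 h2
  · exact absurd (h1.symm.trans h2) hab
  · simp [h1]
  · rw [h2, eq_neg_of_add_eq_zero_right hs]; simp
  · rw [hh x (by simp [h1, h2])]; simp

theorem onlyScalarsCommute_heartRepAlt (hB : 5 ≤ Fintype.card B) :
    OnlyScalarsCommute (heartRepAlt F B) := by
  intro u hu
  have hne : Nonempty B := Fintype.card_pos_iff.1 (by omega)
  have hcomm : ∀ (g : alternatingGroup B) x, u (heartRep F B g x) = heartRep F B g (u x) := by
    intro g x
    have h := LinearMap.congr_fun (hu g) (heartRep F B g x)
    have h1 : heartRepAlt F B g⁻¹ (heartRep F B g x) = x :=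
      Representation.inv_self_apply (heartRepAlt F B) g x
    simp only [Module.End.mul_apply, h1] at h
    exact h.symm
  have hmem : ∀ a b c e : B, a ≠ b → b ≠ c → a ≠ c → e ≠ a → e ≠ b → e ≠ c →
      u (heartMk F B (edgeFun F b a)) ∈ (supportedIn F {a, b, c}).map (heartMk F B) := by
    intro a b c e hab hbc hac hea heb hec
    have h1 : heartMk F B (edgeFun F b a) = heartRep F B (threeCycle a b c hab hbc)
        (heartMk F B (edgeFun F a e)) - heartMk F B (edgeFun F a e) := by
      rw [heartRep_edge, coe_threeCycle, Equiv.Perm.mul_apply, Equiv.Perm.mul_apply,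
        Equiv.swap_apply_of_ne_of_ne hab hac, Equiv.swap_apply_left,
        Equiv.swap_apply_of_ne_of_ne heb hec, Equiv.swap_apply_of_ne_of_ne hea heb, ← map_sub]
      congr 1
      ext x
      simp [edgeFun_apply]
    rw [h1, map_sub, hcomm]
    have h2 : (threeCycle a b c hab hbc : Equiv.Perm B).support ⊆ {a, b, c} := by
      intro x hx
      by_contra hx'
      simp only [Finset.mem_insert, Finset.mem_singleton, not_or] at hx'
      rw [Equiv.Perm.mem_support, coe_threeCycle, Equiv.Perm.mul_apply,
        Equiv.swap_apply_of_ne_of_ne hx'.2.1 hx'.2.2,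
        Equiv.swap_apply_of_ne_of_ne hx'.1 hx'.2.1] at hx
      exact hx rfl
    obtain ⟨k, hk, hk'⟩ := range_heartRep_sub_one_le (threeCycle a b c hab hbc : Equiv.Perm B)
      ⟨u (heartMk F B (edgeFun F a e)), rfl⟩
    exact ⟨k, fun x hx => hk x fun hx' => hx (h2 hx'), hk'⟩
  have hB2 : 1 < Fintype.card B := by omega
  obtain ⟨b, a, hba⟩ := Fintype.one_lt_card_iff.1 hB2
  have hscal : ∃ z : F, u (heartMk F B (edgeFun F b a)) = z • heartMk F B (edgeFun F b a) := by
    obtain ⟨c, hc⟩ := exists_notMem_of_card_lt {a, b} (Finset.card_le_two.trans_lt (by omega))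
    obtain ⟨d, hd⟩ := exists_notMem_of_card_lt {a, b, c} (Finset.card_le_three.trans_lt (by omega))
    obtain ⟨e, he⟩ :=
      exists_notMem_of_card_lt {a, b, c, d} (Finset.card_le_four.trans_lt (by omega))
    simp only [Finset.mem_insert, Finset.mem_singleton, not_or] at hc hd he
    refine exists_smul_edge_of_mem hba ?_
    rw [Finset.pair_comm]
    exact heartMk_supportedIn_inf_le hB (Ne.symm hd.2.2)
      (hmem a b c e hba.symm (Ne.symm hc.2) (Ne.symm hc.1) he.1 he.2.1 he.2.2.1)
      (hmem a b d e hba.symm (Ne.symm hd.2.1) (Ne.symm hd.1) he.1 he.2.1 he.2.2.2)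
  obtain ⟨z, hz⟩ := hscal
  rw [Algebra.mem_bot]
  refine ⟨z, ?_⟩
  have htop : LinearMap.eqLocus u (algebraMap F (Module.End F (Heart F B)) z) = ⊤ := by
    refine eq_top_of_edge_mem fun i j hij => ?_
    obtain ⟨g, rfl, rfl⟩ := exists_alternatingGroup_apply_eq hB hba hij
    rw [LinearMap.mem_eqLocus, ← heartRep_edge, hcomm, hz, map_smul, Module.algebraMap_end_apply]
  refine LinearMap.ext fun x => ?_
  exact (htop.ge (Submodule.mem_top (x := x))).symm

theorem finrank_sumZero_add_one [Nonempty B] :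
    Module.finrank F (sumZero F B) + 1 = Fintype.card B := by
  let f : (B → F) →ₗ[F] F := ∑ b, LinearMap.proj b
  have hf : ∀ h, f h = ∑ b, h b := fun h => by simp [f]
  have hker : sumZero F B = LinearMap.ker f := by
    ext h; rw [LinearMap.mem_ker, hf]; rfl
  have hrange : LinearMap.range f = ⊤ := by
    rw [LinearMap.range_eq_top]
    intro c
    exact ⟨Pi.single (Classical.arbitrary B) c, by simp [hf]⟩
  have h := LinearMap.finrank_range_add_finrank_ker f
  rw [hrange, finrank_top, Module.finrank_self, ← hker, Module.finrank_fintype_fun_eq_card] at h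
  omega

theorem finrank_heart_add_one [Nonempty B] (hB : (Fintype.card B : F) ≠ 0) :
    Module.finrank F (Heart F B) + 1 = Fintype.card B := by
  have h : Module.finrank F (Heart F B) + Module.finrank F (constInSumZero F B) =
      Module.finrank F (sumZero F B) :=
    Submodule.finrank_quotient_add_finrank (constInSumZero F B)
  have h' := finrank_sumZero_add_one (F := F) (B := B)
  have h0 : Module.finrank F (constInSumZero F B) = 0 := by
    rw [constInSumZero_eq_bot F B hB, finrank_bot]
  omega

theorem finrank_heart_add_two [Nonempty B] (hB : (Fintype.card B : F) = 0) :
    Module.finrank F (Heart F B) + 2 = Fintype.card B := by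
  have h : Module.finrank F (Heart F B) + Module.finrank F (constInSumZero F B) =
      Module.finrank F (sumZero F B) :=
    Submodule.finrank_quotient_add_finrank (constInSumZero F B)
  have h' := finrank_sumZero_add_one (F := F) (B := B)
  have h1 : Module.finrank F (constInSumZero F B) = 1 := by
    rw [← Submodule.finrank_map_subtype_eq, map_constInSumZero F B hB, constLine]
    exact finrank_span_singleton fun h => one_ne_zero (congrFun h (Classical.arbitrary B))
  omega

end HeartBasics

section MatrixEndomorphisms

variable {F B : Type*} [Field F] [Fintype B]

/-- All row sums and column sums of the matrix vanish. -/
def IsBalanced (M : Matrix B B F) : Prop :=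
  (∀ b', ∑ b, M b b' = 0) ∧ ∀ b, ∑ b', M b b' = 0

theorem sum_mulVec_eq_zero {M : Matrix B B F} (hM : IsBalanced M) (h : B → F) :
    ∑ b, (M.mulVec h) b = 0 := by
  simp only [Matrix.mulVec, dotProduct]
  rw [Finset.sum_comm]
  simp [← Finset.sum_mul, hM.1]

theorem IsBalanced.submatrix {M : Matrix B B F} (hM : IsBalanced M) (s : Equiv.Perm B) :
    IsBalanced (M.submatrix s s) :=
  ⟨fun b' => (Equiv.sum_comp s (fun b => M b (s b'))).trans (hM.1 _),
    fun b => (Equiv.sum_comp s (fun b' => M (s b) b')).trans (hM.2 _)⟩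

/-- The endomorphism of the heart induced by a matrix with vanishing row and column sums. -/
def matrixEnd (M : Matrix B B F) (hM : IsBalanced M) : Module.End F (Heart F B) :=
  (constInSumZero F B).liftQ
    (heartMk F B ∘ₗ (M.mulVecLin ∘ₗ (sumZero F B).subtype).codRestrict (sumZero F B)
      fun h => sum_mulVec_eq_zero hM h) (by
    intro h hh
    obtain ⟨c, hc⟩ := (mem_constLine_iff F B h).1 hh
    rw [LinearMap.mem_ker, ← map_zero (heartMk F B), LinearMap.comp_apply]
    congr 1
    ext b
    change ∑ b', M b b' * (h : B → F) b' = 0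
    have hc' : ∀ b, (h : B → F) b = c := hc
    simp [hc', ← Finset.sum_mul, hM.2])

theorem matrixEnd_heartMk (M : Matrix B B F) (hM : IsBalanced M) (h : sumZero F B) :
    matrixEnd M hM (heartMk F B h) =
      heartMk F B ⟨M.mulVec (h : B → F), sum_mulVec_eq_zero hM h⟩ := rfl

theorem matrixEnd_commute {M N : Matrix B B F} (hM : IsBalanced M) (hN : IsBalanced N)
    (hMN : M * N = N * M) : matrixEnd M hM * matrixEnd N hN = matrixEnd N hN * matrixEnd M hM := by
  refine LinearMap.ext fun x => ?_
  obtain ⟨h, rfl⟩ := heartMk_surjective x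
  simp only [Module.End.mul_apply, matrixEnd_heartMk, Matrix.mulVec_mulVec, hMN]

theorem heartRep_mul_matrixEnd_mul (M : Matrix B B F) (hM : IsBalanced M) (s : Equiv.Perm B) :
    heartRep F B s * matrixEnd M hM * heartRep F B s⁻¹ =
      matrixEnd (M.submatrix (s⁻¹ : Equiv.Perm B) (s⁻¹ : Equiv.Perm B)) (hM.submatrix _) := by
  refine LinearMap.ext fun x => ?_
  obtain ⟨h, rfl⟩ := heartMk_surjective x
  simp only [Module.End.mul_apply, matrixEnd_heartMk, heartRep_heartMk]
  congr 1
  ext b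
  change ∑ b', M (s⁻¹ b) b' * (h : B → F) (s⁻¹⁻¹ b') =
    ∑ b', M (s⁻¹ b) (s⁻¹ b') * (h : B → F) b'
  rw [← Equiv.sum_comp (s⁻¹ : Equiv.Perm B)]
  simp

theorem exists_of_matrixEnd_mem_bot [DecidableEq B] {M : Matrix B B F} (hM : IsBalanced M)
    (h : matrixEnd M hM ∈ (⊥ : Subalgebra F (Module.End F (Heart F B)))) (a b : B) :
    ∃ z c : F, ∀ x, M x a - M x b -
      z * ((if x = a then 1 else 0) - (if x = b then 1 else 0)) = c := by
  obtain ⟨z, hz⟩ := Algebra.mem_bot.1 h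
  have h1 := LinearMap.congr_fun hz (heartMk F B (edgeFun F a b))
  rw [Module.algebraMap_end_apply, ← map_smul, matrixEnd_heartMk] at h1
  obtain ⟨c, hc⟩ := heartMk_eq_iff.1 h1.symm
  refine ⟨z, c, fun x => ?_⟩
  rw [← hc x]
  have h2 : (M.mulVec (edgeFun F a b : B → F)) x = M x a - M x b := by
    simp [edgeFun, Matrix.mulVec_sub]
  change _ = (M.mulVec (edgeFun F a b : B → F)) x - z * (edgeFun F a b : B → F) x
  rw [h2, edgeFun_apply]

end MatrixEndomorphisms

section FivePoints

/-- The first row of a skew-symmetric circulant matrix of size five. -/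
def skewRow {A : Type*} [Ring A] (a b : A) : Fin 5 → A := ![0, a, b, -b, -a]

theorem skewRow_add_mul {A : Type*} [CommRing A] (t : A) (a b a' b' : ℤ) (i : Fin 5) :
    skewRow (a + t * a' : A) (b + t * b') i = (skewRow a b i : ℤ) + t * (skewRow a' b' i : ℤ) := by
  fin_cases i <;> simp [skewRow] <;> ring

theorem sum_skewRow {A : Type*} [CommRing A] (a b : A) : ∑ i, skewRow a b i = 0 := by
  simp [skewRow, Fin.sum_univ_succ]

theorem skewRow_int_commute (g : Equiv.Perm (Fin 5)) (hg : Equiv.Perm.sign g = 1) (i j : Fin 5) :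
    (∑ k, ((skewRow 1 0 (k - i) : ℤ) * skewRow 0 (-1) (g j - g k) +
      skewRow 0 1 (k - i) * skewRow 1 0 (g j - g k)) =
    ∑ k, ((skewRow 1 0 (j - k) : ℤ) * skewRow 0 (-1) (g k - g i) +
      skewRow 0 1 (j - k) * skewRow 1 0 (g k - g i))) ∧
    (∑ k, ((skewRow 1 0 (k - i) : ℤ) * skewRow 1 0 (g j - g k) +
      skewRow 0 1 (k - i) * skewRow 4 (-1) (g j - g k)) =
    ∑ k, ((skewRow 1 0 (j - k) : ℤ) * skewRow 1 0 (g k - g i) +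
      skewRow 0 1 (j - k) * skewRow 4 (-1) (g k - g i))) := by
  revert g
  decide +kernel +revert

theorem skewRow_commute {A : Type*} [CommRing A] {t : A} (ht : t ^ 2 = 4 * t + 1)
    (g : Equiv.Perm (Fin 5)) (hg : Equiv.Perm.sign g = 1) (i j : Fin 5) :
    ∑ k, skewRow 1 t (k - i) * skewRow t (-1) (g j - g k) =
      ∑ k, skewRow t (-1) (g k - g i) * skewRow 1 t (j - k) := by
  have h1 : ∀ l, skewRow 1 t l = (skewRow 1 0 l : ℤ) + t * (skewRow 0 1 l : ℤ) := fun l => by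
    simpa using skewRow_add_mul t 1 0 0 1 l
  have h2 : ∀ l, skewRow t (-1) l = (skewRow 0 (-1) l : ℤ) + t * (skewRow 1 0 l : ℤ) := fun l => by
    simpa using skewRow_add_mul t 0 (-1) 1 0 l
  have h3 : ∀ l, (skewRow 4 (-1) l : ℤ) = skewRow 0 (-1) l + 4 * skewRow 1 0 l := by decide
  have key : ∀ l l', skewRow 1 t l * skewRow t (-1) l' =
      ((skewRow 1 0 l * skewRow 0 (-1) l' + skewRow 0 1 l * skewRow 1 0 l' : ℤ) : A) +
      t * ((skewRow 1 0 l * skewRow 1 0 l' + skewRow 0 1 l * skewRow 4 (-1) l' : ℤ) : A) := by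
    intro l l'
    rw [h1, h2, h3]
    push_cast
    linear_combination ((skewRow 0 1 l : ℤ) : A) * ((skewRow 1 0 l' : ℤ) : A) * ht
  obtain ⟨hA, hB⟩ := skewRow_int_commute g hg i j
  simp only [mul_comm (skewRow t (-1) _) (skewRow 1 t _), key, Finset.sum_add_distrib,
    ← Finset.mul_sum, ← Int.cast_sum, hA, hB]

variable {F B : Type*} [Field F] [Fintype B]

/-- The skew circulant matrix with coefficients `α` and `β`, on a set identified with `Fin 5`. -/
def skewCirculant (e : B ≃ Fin 5) (α β : F) : Matrix B B F :=
  Matrix.of fun b b' => skewRow α β (e b' - e b)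

theorem isBalanced_skewCirculant (e : B ≃ Fin 5) (α β : F) :
    IsBalanced (skewCirculant e α β) := by
  refine ⟨fun b' => ?_, fun b => ?_⟩
  · rw [← sum_skewRow α β]
    exact Equiv.sum_comp (e.trans (Equiv.subLeft (e b'))) (skewRow α β)
  · rw [← sum_skewRow α β]
    exact Equiv.sum_comp (e.trans (Equiv.subRight (e b))) (skewRow α β)

variable [DecidableEq B]

theorem matrixEnd_skewCirculant_notMem_bot (e : B ≃ Fin 5) {α β : F} (h2 : (2 : F) ≠ 0)
    (h5 : (5 : F) ≠ 0) (hβ : β ≠ 0) :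
    matrixEnd (skewCirculant e α β) (isBalanced_skewCirculant e α β) ∉
      (⊥ : Subalgebra F (Module.End F (Heart F B))) := by
  intro h
  obtain ⟨z, c, hc⟩ := exists_of_matrixEnd_mem_bot _ h (e.symm 0) (e.symm 1)
  have h' : ∀ i : Fin 5, skewRow α β (0 - i) - skewRow α β (1 - i) -
      z * ((if i = 0 then 1 else 0) - (if i = 1 then 1 else 0)) = c := by
    intro i
    simpa [skewCirculant] using hc (e.symm i)
  have e0 : -α - z = c := by simpa [skewRow] using h' 0
  have e1 : -α + z = c := by simpa [skewRow] using h' 1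
  have e2 : -β - -α = c := by simpa [skewRow] using h' 2
  have e3 : β - -β = c := by simpa [skewRow] using h' 3
  have h10 : (2 : F) * 5 * β = 0 := by linear_combination 4 * e3 - 2 * e2 - e0 - e1
  exact mul_ne_zero (mul_ne_zero h2 h5) hβ h10

theorem skewCirculant_mul_submatrix (e : B ≃ Fin 5) {t : F} (ht : t ^ 2 = 4 * t + 1)
    (g : Equiv.Perm B) (hg : Equiv.Perm.sign g = 1) :
    skewCirculant e 1 t * (skewCirculant e t (-1)).submatrix g g =
      (skewCirculant e t (-1)).submatrix g g * skewCirculant e 1 t := by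
  ext b b'
  have h := skewRow_commute ht (e.permCongr g) (by rw [Equiv.Perm.sign_permCongr, hg]) (e b) (e b')
  rw [← Equiv.sum_comp e, ← Equiv.sum_comp e] at h
  simpa [Matrix.mul_apply, skewCirculant] using h

theorem not_isVerySimple_heartRepAlt (hB : Fintype.card B = 5) {t : F} (ht : t ^ 2 = 4 * t + 1)
    (h2 : (2 : F) ≠ 0) (h5 : (5 : F) ≠ 0) : ¬ IsVerySimple (heartRepAlt F B) := by
  intro hvs
  have e : B ≃ Fin 5 := Fintype.equivFinOfCardEq hB
  let J := matrixEnd (skewCirculant e 1 t) (isBalanced_skewCirculant e 1 t)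
  let J' := matrixEnd (skewCirculant e t (-1)) (isBalanced_skewCirculant e t (-1))
  let ρ := heartRepAlt F B
  let R := Subalgebra.centralizer F (Set.range fun g => ρ g * J' * ρ g⁻¹)
  have hmem : ∀ u, u ∈ R ↔ ∀ g, ρ g * J' * ρ g⁻¹ * u = u * (ρ g * J' * ρ g⁻¹) := fun u => by
    simp only [R, Subalgebra.mem_centralizer_iff, Set.forall_mem_range]
  have hR : IsNormalSubalgebra ρ R := by
    intro s u hu
    rw [hmem] at hu ⊢
    intro g
    have h := congrArg (fun x => ρ s * x * ρ s⁻¹) (hu (s⁻¹ * g))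
    have hss : ρ s * ρ s⁻¹ = 1 := by rw [← map_mul, mul_inv_cancel, map_one]
    have hconj : ρ (s⁻¹ * g) * J' * ρ (s⁻¹ * g)⁻¹ = ρ s⁻¹ * (ρ g * J' * ρ g⁻¹) * ρ s := by
      rw [mul_inv_rev, inv_inv, map_mul, map_mul]; simp only [mul_assoc]
    rw [hconj] at h
    set X := ρ g * J' * ρ g⁻¹
    calc X * (ρ s * u * ρ s⁻¹) = ρ s * ρ s⁻¹ * (X * (ρ s * u * ρ s⁻¹)) := by rw [hss, one_mul]
      _ = ρ s * (ρ s⁻¹ * X * ρ s * u) * ρ s⁻¹ := by simp only [mul_assoc]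
      _ = ρ s * (u * (ρ s⁻¹ * X * ρ s)) * ρ s⁻¹ := h
      _ = ρ s * u * ρ s⁻¹ * X * (ρ s * ρ s⁻¹) := by simp only [mul_assoc]
      _ = ρ s * u * ρ s⁻¹ * X := by rw [hss, mul_one]
  have hJ : J ∈ R := by
    rw [hmem]
    intro g
    have h := heartRep_mul_matrixEnd_mul (skewCirculant e t (-1))
      (isBalanced_skewCirculant e t (-1)) (g : Equiv.Perm B)
    have h' : ρ g * J' * ρ g⁻¹ = _ := h
    rw [h']
    refine (matrixEnd_commute _ _ (skewCirculant_mul_submatrix e ht _ ?_)).symm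
    rw [Equiv.Perm.sign_inv]
    exact g.2
  have ht0 : t ≠ 0 := by
    rintro rfl
    norm_num at ht
  rcases hvs R hR with h | h
  · exact matrixEnd_skewCirculant_notMem_bot e h2 h5 ht0 (h ▸ hJ)
  · refine matrixEnd_skewCirculant_notMem_bot e (α := t) h2 h5 (neg_ne_zero.2 one_ne_zero)
      (Algebra.IsCentral.out (D := Module.End F (Heart F B)) ?_)
    rw [Subalgebra.mem_center_iff]
    intro u
    have hu : u ∈ R := h ▸ Algebra.mem_top
    have := (hmem u).1 hu 1
    simpa using this.symm

end FivePoints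

section AlternatingGroup

variable {B : Type*} [Fintype B] [DecidableEq B]

theorem closure_isThreeCycle_eq_top (hB : 5 ≤ Fintype.card B) :
    Subgroup.closure {g : alternatingGroup B | (g : Equiv.Perm B).IsThreeCycle} = ⊤ := by
  obtain ⟨a, b, c, hab, hac, hbc⟩ := Fintype.two_lt_card_iff.1 (show 2 < Fintype.card B by omega)
  have hs := Equiv.Perm.isThreeCycle_swap_mul_swap_same hab hac hbc
  have : IsSimpleGroup (alternatingGroup B) :=
    alternatingGroup.isSimpleGroup (by rwa [Nat.card_eq_fintype_card])
  have htop : Subgroup.normalClosure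
      {(⟨_, hs.mem_alternatingGroup⟩ : alternatingGroup B)} = ⊤ :=
    Subgroup.normalClosure_normal.eq_bot_or_eq_top.resolve_left (by simp [hs.ne_one])
  rw [eq_top_iff, ← htop, Subgroup.normalClosure, Subgroup.closure_le]
  intro x hx
  refine Subgroup.subset_closure ?_
  rw [Group.conjugatesOfSet, Set.biUnion_singleton] at hx
  obtain ⟨y, rfl⟩ := isConj_iff.1 hx
  change Equiv.Perm.IsThreeCycle ((y : Equiv.Perm B) * _ * (y : Equiv.Perm B)⁻¹)
  rw [Equiv.Perm.IsThreeCycle, Equiv.Perm.cycleType_conj]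
  exact hs

theorem monoidHom_perm_eq_one (hB : 5 ≤ Fintype.card B) {m : ℕ} (hm : m < Fintype.card B)
    (f : alternatingGroup B →* Equiv.Perm (Fin m)) : f = 1 := by
  have : IsSimpleGroup (alternatingGroup B) :=
    alternatingGroup.isSimpleGroup (by rwa [Nat.card_eq_fintype_card])
  have : Nontrivial B := Fintype.one_lt_card_iff_nontrivial.1 (by omega)
  rw [← MonoidHom.ker_eq_top_iff]
  refine (IsSimpleGroup.eq_bot_or_eq_top_of_normal f.ker inferInstance).resolve_left fun h => ?_
  have hle := Fintype.card_le_of_injective f ((MonoidHom.ker_eq_bot_iff f).1 h)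
  have h2 := two_mul_card_alternatingGroup (α := B)
  rw [Fintype.card_perm] at h2 hle
  rw [Fintype.card_fin] at hle
  obtain ⟨k, hk⟩ : ∃ k, Fintype.card B = k + 1 := ⟨Fintype.card B - 1, by omega⟩
  have hmk : m.factorial ≤ k.factorial := Nat.factorial_le (by omega)
  rw [hk, Nat.factorial_succ] at h2
  have hpos := Nat.factorial_pos k
  have : 5 * k.factorial ≤ (k + 1) * k.factorial := Nat.mul_le_mul_right _ (by omega)
  omega

theorem exists_pow_five_eq_one (hB : 5 ≤ Fintype.card B) :
    ∃ g : alternatingGroup B, g ≠ 1 ∧ g ^ 5 = 1 := by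
  have : Nontrivial B := Fintype.one_lt_card_iff_nontrivial.1 (by omega)
  have h2 := two_mul_card_alternatingGroup (α := B)
  rw [Fintype.card_perm] at h2
  have hdvd : 5 ∣ 2 * Fintype.card (alternatingGroup B) :=
    h2 ▸ Nat.dvd_factorial (by norm_num) hB
  have : Fact (Nat.Prime 5) := ⟨Nat.prime_five⟩
  obtain ⟨g, hg⟩ := exists_prime_orderOf_dvd_card 5
    (Nat.Coprime.dvd_of_dvd_mul_left (by norm_num) hdvd)
  refine ⟨g, fun h => ?_, hg ▸ pow_orderOf_eq_one g⟩
  rw [h, orderOf_one] at hg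
  omega

end AlternatingGroup

section Conclusion

variable {B : Type*} [Fintype B] [DecidableEq B] {p : ℕ} [Fact p.Prime]

theorem finrank_heart_lt {F : Type*} [Field F] (hB : 5 ≤ Fintype.card B) :
    2 < Module.finrank F (Heart F B) ∧ Module.finrank F (Heart F B) < Fintype.card B := by
  have hne : Nonempty B := Fintype.card_pos_iff.1 (by omega)
  by_cases h : (Fintype.card B : F) = 0
  · have := finrank_heart_add_two h
    omega
  · have := finrank_heart_add_one h
    omega

theorem nontrivial_heart {F : Type*} [Field F] (hB : 5 ≤ Fintype.card B) :
    Nontrivial (Heart F B) :=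
  Module.nontrivial_of_finrank_pos (R := F) (by have := (finrank_heart_lt (F := F) hB).1; omega)

theorem isCentralSimple_of_isNormalSubalgebra {F : Type*} [Field F] [Fintype F]
    (hB : 5 ≤ Fintype.card B) {R : Subalgebra F (Module.End F (Heart F B))}
    (hR : IsNormalSubalgebra (heartRepAlt F B) R) : Algebra.IsCentral F R ∧ IsSimpleRing R := by
  have := nontrivial_heart (F := F) hB
  have hsimple : IsSimpleRing R := isSimpleRing_of_isNormalSubalgebra
    (noInvariantSubspace_heartRepAlt hB)
    (fun m hm f => monoidHom_perm_eq_one hB (hm.trans_lt (finrank_heart_lt hB).2) f) hR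
  exact ⟨isCentral_of_isSimpleRing (onlyScalarsCommute_heartRepAlt hB)
    (commutator_alternatingGroup_eq_top (by rwa [Nat.card_eq_fintype_card])) hR, hsimple⟩

theorem heart_classification {F : Type*} [Field F] [Fintype F] (hB : 5 ≤ Fintype.card B)
    {R : Subalgebra F (Module.End F (Heart F B))} (hR : IsNormalSubalgebra (heartRepAlt F B) R) :
    R = ⊥ ∨ R = ⊤ ∨ (Module.finrank F (Heart F B) = 4 ∧
      5 ∣ Fintype.card F * (Fintype.card F ^ 2 - 1) ∧
      Nonempty (R ≃ₐ[F] Matrix (Fin 2) (Fin 2) F) ∧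
      HasSimplePlane R) := by
  have := nontrivial_heart (F := F) hB
  have : IsSimpleGroup (alternatingGroup B) :=
    alternatingGroup.isSimpleGroup (by rwa [Nat.card_eq_fintype_card])
  obtain ⟨hcen, hsimple⟩ := isCentralSimple_of_isNormalSubalgebra hB hR
  obtain ⟨g, hg1, hg⟩ := exists_pow_five_eq_one hB
  refine eq_bot_or_top_or_of_isNormalSubalgebra (noInvariantSubspace_heartRepAlt hB)
    (onlyScalarsCommute_heartRepAlt hB) (closure_isThreeCycle_eq_top hB) (fun s hs => ?_)
    Nat.prime_five hg1 hg hR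
  have hs' : (s : Equiv.Perm B).IsThreeCycle := hs
  have h := finrank_range_heartRep_sub_one_le (F := F) hs'.ne_one
  rwa [hs'.card_support] at h

theorem isVerySimple_heartRep {F : Type*} [Field F] [Fintype F] (hB : 5 ≤ Fintype.card B) :
    IsVerySimple (heartRep F B) := by
  intro R hR
  have hR' : IsNormalSubalgebra (heartRepAlt F B) R := fun g => hR g
  rcases heart_classification hB hR' with h | h | ⟨h4, -, -, hplane⟩
  · exact Or.inl h
  · exact Or.inr h
  have hirr : NoInvariantSubspace (heartRep F B) := fun U hU =>
    noInvariantSubspace_heartRepAlt hB U fun g => hU g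
  refine absurd hplane (not_hasSimplePlane hirr Equiv.Perm.closure_isSwap (fun s hs => ?_)
    (by omega) hR)
  have hs2 := Equiv.Perm.card_support_eq_two.2 hs
  have hs1 : s ≠ 1 := by
    rintro rfl
    simp at hs2
  have h := finrank_range_heartRep_sub_one_le (F := F) hs1
  rwa [hs2] at h

theorem card_eq_five_of_finrank_eq_four (hB : 5 ≤ Fintype.card B)
    (h4 : Module.finrank (ZMod p) (Heart (ZMod p) B) = 4)
    (hdvd : 5 ∣ Fintype.card (ZMod p) * (Fintype.card (ZMod p) ^ 2 - 1)) :
    Fintype.card B = 5 ∧ ((p : ℤ) ≡ 1 [ZMOD 5] ∨ (p : ℤ) ≡ -1 [ZMOD 5]) := by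
  have hp : p.Prime := Fact.out
  have hne : Nonempty B := Fintype.card_pos_iff.1 (by omega)
  rw [ZMod.card] at hdvd
  by_cases h : (Fintype.card B : ZMod p) = 0
  · exfalso
    have h6 : Fintype.card B = 6 := by
      have := finrank_heart_add_two h
      omega
    rw [h6, ZMod.natCast_eq_zero_iff] at h
    have hp6 : p ≤ 6 := Nat.le_of_dvd (by norm_num) h
    interval_cases p <;> revert hdvd h hp <;> decide
  · have h5 : Fintype.card B = 5 := by
      have := finrank_heart_add_one h
      omega
    refine ⟨h5, ?_⟩
    rw [h5] at h
    have hp5 : p ≠ 5 := by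
      rintro rfl
      exact h (ZMod.natCast_self 5)
    have hnp : ¬ 5 ∣ p := fun hd => hp5 ((Nat.prime_dvd_prime_iff_eq Nat.prime_five hp).1 hd).symm
    have hd := (Nat.prime_five.dvd_mul.1 hdvd).resolve_left hnp
    rw [show p ^ 2 - 1 = (p + 1) * (p - 1) by simpa using Nat.sq_sub_sq p 1,
      Nat.prime_five.dvd_mul] at hd
    have := hp.one_lt
    rcases hd with hd | hd
    · right
      rw [Int.modEq_iff_dvd]
      omega
    · left
      rw [Int.modEq_iff_dvd]
      omega

theorem exists_sq_eq_four_mul_add_one (hp : (p : ℤ) ≡ 1 [ZMOD 5] ∨ (p : ℤ) ≡ -1 [ZMOD 5]) :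
    ∃ t : ZMod p, t ^ 2 = 4 * t + 1 := by
  have : Fact (Nat.Prime 5) := ⟨Nat.prime_five⟩
  have hp2 : p ≠ 2 := by
    rintro rfl
    revert hp
    decide
  have hsq : IsSquare ((p : ℕ) : ZMod 5) := by
    rcases hp with h | h
    · have h' := (ZMod.intCast_eq_intCast_iff _ _ 5).2 h
      refine ⟨1, ?_⟩
      simpa using h'
    · have h' := (ZMod.intCast_eq_intCast_iff _ _ 5).2 h
      refine ⟨2, ?_⟩
      have h'' : ((p : ℕ) : ZMod 5) = -1 := by simpa using h'
      rw [h'']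
      rfl
  obtain ⟨s, hs⟩ := (ZMod.exists_sq_eq_prime_iff_of_mod_four_eq_one (p := 5) (q := p)
    (by norm_num) hp2).1 hsq
  refine ⟨2 + s, ?_⟩
  push_cast at hs
  linear_combination -hs

end Conclusion

end HeartModule

theorem mainTheorem8 (n : ℕ) (hn : 5 ≤ n) (B : Type*) [Fintype B] [DecidableEq B]
    (hB : Fintype.card B = n) (p : ℕ) [Fact p.Prime] :
    -- the heart is a very simple `Perm(B)`-module
    HeartModule.IsVerySimple (HeartModule.heartRep (ZMod p) B) ∧
    -- it is a very simple `Alt(B)`-module iff `n > 5`, or `n = 5` and `p ≢ ±1 mod 5`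
    (HeartModule.IsVerySimple (HeartModule.heartRepAlt (ZMod p) B) ↔
      5 < n ∨ (n = 5 ∧ ¬ ((p : ℤ) ≡ 1 [ZMOD 5] ∨ (p : ℤ) ≡ -1 [ZMOD 5]))) ∧
    -- if `n = 5` and `p ≡ ±1 mod 5`, the `Alt(B)`-normal subalgebras
    (n = 5 → ((p : ℤ) ≡ 1 [ZMOD 5] ∨ (p : ℤ) ≡ -1 [ZMOD 5]) →
      ∀ R : Subalgebra (ZMod p) (Module.End (ZMod p) (HeartModule.Heart (ZMod p) B)),
        HeartModule.IsNormalSubalgebra (HeartModule.heartRepAlt (ZMod p) B) R →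
          R = ⊥ ∨ R = ⊤ ∨ Nonempty (R ≃ₐ[ZMod p] Matrix (Fin 2) (Fin 2) (ZMod p))) ∧
    -- the heart is a central simple `Alt(B)`-module
    HeartModule.IsCentralSimpleModule (HeartModule.heartRepAlt (ZMod p) B) := by
  subst hB
  refine ⟨HeartModule.isVerySimple_heartRep hn, ⟨fun hvs => ?_, fun hcond R hR => ?_⟩,
    fun _ _ R hR => ?_, fun R hR => HeartModule.isCentralSimple_of_isNormalSubalgebra hn hR⟩
  · rcases hn.lt_or_eq with h | h
    · exact Or.inl h
    · refine Or.inr ⟨h.symm, fun hp => ?_⟩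
      obtain ⟨t, ht⟩ := HeartModule.exists_sq_eq_four_mul_add_one hp
      have hprime : p.Prime := Fact.out
      have hne : ∀ q : ℕ, q.Prime → ¬ ((q : ℤ) ≡ 1 [ZMOD 5] ∨ (q : ℤ) ≡ -1 [ZMOD 5]) →
          (q : ZMod p) ≠ 0 := fun q hq hq' h0 => by
        rw [ZMod.natCast_eq_zero_iff, Nat.prime_dvd_prime_iff_eq hprime hq] at h0
        exact hq' (h0 ▸ hp)
      exact HeartModule.not_isVerySimple_heartRepAlt h.symm ht
        (by exact_mod_cast hne 2 Nat.prime_two (by decide))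
        (by exact_mod_cast hne 5 Nat.prime_five (by decide)) hvs
  · rcases HeartModule.heart_classification hn hR with h | h | ⟨h4, hdvd, -⟩
    · exact Or.inl h
    · exact Or.inr h
    · obtain ⟨h5, hp⟩ := HeartModule.card_eq_five_of_finrank_eq_four hn h4 hdvd
      rcases hcond with h | h
      · omega
      · exact absurd hp h.2
  · rcases HeartModule.heart_classification hn hR with h | h | ⟨-, -, h, -⟩
    · exact Or.inl h
    · exact Or.inr (Or.inl h)
    · exact Or.inr (Or.inr h)
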